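/- A north/east path is a lattice path with unit steps $(0,1)$ and $(1,0)$. A parallelogram polyomino is a polyomino (a finite set of unit cells of the square lattice, considered up to translation) that is the region enclosed by two north/east paths with the same starting point and the same endpoint that have no other point in common. For a parallelogram polyomino $P$ let $a(P)$ be its area (number of cells), $h(P)$ its height (number of rows) and $w(P)$ its width (number of columns); the length of a column is its number of cells. For integers $N,j\ge 0$ let $$\begin{bmatrix}N\\j\end{bmatrix}_q=\frac{(1-q^N)(1-q^{N-1})\cdots(1-q^{N-j+1})}{(1-q^j)(1-q^{j-1})\cdots(1-q)}.$$ Let $k$ be a positive integer. Then, as formal power series in $q,y,x$, $$\sum_{P}q^{a(P)}y^{h(P)}x^{2w(P)} =-\,\frac{\displaystyle y\sum_{j=1}^{k}(-1)^{j}x^{2j}q^{\binom{j+1}{2}}\sum_{i=0}^{k-j}(yq)^i\begin{bmatrix}k-i-1\\j-1\end{bmatrix}_q\begin{bmatrix}i+j-1\\j-1\end{bmatrix}_q} {\displaystyle 1+\sum_{j=1}^{k}(-1)^{j}x^{2j}q^{\binom{j+1}{2}}\sum_{i=0}^{k-j}(yq)^i\begin{bmatrix}k-i\\j\end{bmatrix}_q\begin{bmatrix}i+j-1\\j-1\end{bmatrix}_q},$$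 where the sum on the left is over all parallelogram polyominoes $P$ all of whose columns have length at most $k$. (Only finitely many $P$ contribute to each monomial, and the denominator on the right has constant term $1$.) -/

import Mathlib

namespace ParallelogramPolyomino

/-- The two unit steps of a lattice path: `north` is `(0,1)`, `east` is `(1,0)`. -/
inductive Step where
  | north : Step
  | east : Step
deriving DecidableEq

/-- The endpoint of the lattice path that starts at the origin and has the given steps. -/
def endpoint (p : List Step) : ℕ × ℕ := (p.count Step.east, p.count Step.north)

/-- The ordinates of the east steps of a path, from left to right, if the path starts at
ordinate `h`. The entry with index `a` belongs to the east step from abscissa `a` to `a + 1`. -/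
def eastHeights : ℕ → List Step → List ℕ
  | _, [] => []
  | h, Step.north :: p => eastHeights (h + 1) p
  | h, Step.east :: p => h :: eastHeights h p

/-- `u` and `l` are the upper and the lower boundary path of a parallelogram polyomino: both are
north/east paths which start at the origin, they have the same endpoint, they have no other
point in common, and `u` runs above `l`. (Two such paths can meet in a lattice point only after
the same number of steps; when they have not met, `u` has made more north steps than `l`. The
length is at least two, so that the enclosed region is not degenerate.) -/
structure IsBoundary (u l : List Step) : Prop where
  two_le : 2 ≤ u.length
  endpoint_eq : endpoint u = endpoint l
  above : ∀ i, 0 < i → i < u.length →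
    (endpoint (l.take i)).2 < (endpoint (u.take i)).2

/-- The cell `(a, b)`, i.e. the unit square `[a, a+1] × [b, b+1]`, lies above the path `l` and
below the path `u`. -/
def CellBetween (u l : List Step) (a b : ℕ) : Prop :=
  ∃ lo hi : ℕ, (eastHeights 0 l)[a]? = some lo ∧ (eastHeights 0 u)[a]? = some hi ∧
    lo ≤ b ∧ b < hi

/-- A parallelogram polyomino, as a finite set of cells (`(a, b)` stands for the unit square
`[a, a+1] × [b, b+1]`): the cells enclosed by a pair of boundary paths. As polyominoes are
considered up to translation, the lower left corner is placed at the origin. -/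
def IsParallelogram (P : Finset (ℕ × ℕ)) : Prop :=
  ∃ u l : List Step, IsBoundary u l ∧ ∀ a b : ℕ, (a, b) ∈ P ↔ CellBetween u l a b

/-- The area: the number of cells. -/
def area (P : Finset (ℕ × ℕ)) : ℕ := P.card

/-- The width: the number of (non-empty) columns. -/
def width (P : Finset (ℕ × ℕ)) : ℕ := (P.image Prod.fst).card

/-- The height: the number of (non-empty) rows. -/
def height (P : Finset (ℕ × ℕ)) : ℕ := (P.image Prod.snd).card

/-- The length of column `a`: the number of its cells. -/
def columnLength (P : Finset (ℕ × ℕ)) (a : ℕ) : ℕ := (P.filter (fun c => c.1 = a)).card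

/-- Formal power series in the three variables `q`, `y`, `x` with rational coefficients. -/
abbrev Series : Type := MvPowerSeries (Fin 3) ℚ

/-- The variable `q`. -/
noncomputable def q : Series := MvPowerSeries.X 0

/-- The variable `y`. -/
noncomputable def y : Series := MvPowerSeries.X 1

/-- The variable `x`. -/
noncomputable def x : Series := MvPowerSeries.X 2

/-- The parallelogram polyominoes with all column lengths at most `k` whose weight
`q ^ area * y ^ height * x ^ (2 * width)` is the monomial with exponents `m`. -/
def polyominoesWithWeight (k : ℕ) (m : Fin 3 →₀ ℕ) : Set (Finset (ℕ × ℕ)) :=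
  {P | IsParallelogram P ∧ (∀ a, columnLength P a ≤ k) ∧
    area P = m 0 ∧ height P = m 1 ∧ 2 * width P = m 2}

/-- The generating function `∑ q ^ area(P) * y ^ height(P) * x ^ (2 * width(P))` over all
parallelogram polyominoes `P` with all column lengths at most `k`. -/
noncomputable def genFun (k : ℕ) : Series :=
  fun m => ((polyominoesWithWeight k m).ncard : ℚ)

/-- The `q`-binomial coefficient
`(1 - q^N) ⋯ (1 - q^(N-j+1)) / ((1 - q^j) ⋯ (1 - q))`. For `N < j` the numerator contains the
factor `1 - q^0 = 0`. The denominator has constant term `1`, so it is invertible. -/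
noncomputable def qBinom (N j : ℕ) : Series :=
  (∏ t ∈ Finset.range j, (1 - q ^ (N - t))) * (∏ t ∈ Finset.range j, (1 - q ^ (t + 1)))⁻¹

/-- The double sum in the numerator. -/
noncomputable def numer (k : ℕ) : Series :=
  ∑ j ∈ Finset.Icc 1 k, (-1) ^ j * x ^ (2 * j) * q ^ (j + 1).choose 2 *
    ∑ i ∈ Finset.range (k - j + 1),
      (y * q) ^ i * qBinom (k - i - 1) (j - 1) * qBinom (i + j - 1) (j - 1)

/-- The double sum in the denominator. The summand `1` is the contribution of `j = 0`, where the
`q`-binomial coefficient with upper entry `i - 1` and lower entry `-1` is `1` for `i = 0` and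
`0` for `i ≥ 1`. -/
noncomputable def denom (k : ℕ) : Series :=
  1 + ∑ j ∈ Finset.Icc 1 k, (-1) ^ j * x ^ (2 * j) * q ^ (j + 1).choose 2 *
    ∑ i ∈ Finset.range (k - j + 1),
      (y * q) ^ i * qBinom (k - i) j * qBinom (i + j - 1) (j - 1)

end ParallelogramPolyomino

namespace ParallelogramPolyomino

/-! ### Gaussian binomial coefficients -/

/-! A parallelogram polyomino is a sequence of columns, each starting and ending at least as high as
its left neighbour and sharing at least one row with it. Let `F n` be the generating function of the
sequences whose first column has length `n`, with the height of that column not counted. If the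
second column has length `r` and overlaps the first in `m` rows, it adds `r - m` rows, so `F n = x²
qⁿ (1 + ∑_{1≤m≤n} ∑_{m≤r≤k} y^(r-m) F r)`. Write `D_d(z)`, `N_d(z)` for `denomPoly d z`, `numerPoly
d z`. The q-Pascal rule gives `N_{d+1}(z) = zq D_d(zq) + y N_d(zq)` and `D_{d+1}(z) = D_d(zq) -
N_{d+1}(z)`. At `z = x² qⁿ`, `d = k - n` the shift `z ↦ zq` becomes `n ↦ n + 1`, and the recurrences
say that `x² qⁿ D_{k-n}(x² qⁿ)` solves the linear system multiplied by `denom k` (`sum_solution`,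
`solution_eq`). The system has only one solution, because its operator carries a factor `x²`:
iteration determines everything modulo `x^(2M)` for every `M` (`dvd_solution_sub`). Summing `yⁿ F n`
over `n` gives the quotient. The geometric input is `isParallelogram_iff`, the enumerative one
`sum_weight_columnsFrom`. -/

lemma constantCoeff_one_sub_q_pow (t : ℕ) :
    MvPowerSeries.constantCoeff (1 - q ^ (t + 1) : Series) = 1 := by
  simp [q]

lemma constantCoeff_qFactorial (j : ℕ) :
    MvPowerSeries.constantCoeff (∏ t ∈ Finset.range j, (1 - q ^ (t + 1)) : Series) = 1 := by
  rw [map_prod]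
  exact Finset.prod_eq_one fun t _ => constantCoeff_one_sub_q_pow t

lemma qBinom_mul (N j : ℕ) :
    qBinom N j * ∏ t ∈ Finset.range j, (1 - q ^ (t + 1)) =
      ∏ t ∈ Finset.range j, (1 - q ^ (N - t)) := by
  rw [qBinom, mul_assoc, MvPowerSeries.inv_mul_cancel, mul_one]
  rw [constantCoeff_qFactorial]
  exact one_ne_zero

@[simp] lemma qBinom_zero_right (N : ℕ) : qBinom N 0 = 1 := by
  have h := qBinom_mul N 0
  simpa using h

lemma qBinom_eq_zero {N j : ℕ} (h : N < j) : qBinom N j = 0 := by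
  rw [qBinom, Finset.prod_eq_zero (Finset.mem_range.2 h) (by simp), zero_mul]

lemma qBinom_succ_succ (N j : ℕ) :
    qBinom (N + 1) (j + 1) = q ^ (j + 1) * qBinom N (j + 1) + qBinom N j := by
  have hne : (∏ t ∈ Finset.range (j + 1), (1 - q ^ (t + 1)) : Series) ≠ 0 := fun h => by
    have := constantCoeff_qFactorial (j + 1)
    rw [h] at this
    simp at this
  apply mul_right_cancel₀ hne
  rw [add_mul, mul_assoc, qBinom_mul, qBinom_mul,
    Finset.prod_range_succ (fun t => (1 - q ^ (t + 1) : Series)), ← mul_assoc (qBinom N j),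
    qBinom_mul, Finset.prod_range_succ', Finset.prod_range_succ]
  simp only [Nat.add_sub_add_right, Nat.sub_zero]
  -- For `j ≤ N` this is `1 - q^(N+1) = q^(j+1) (1 - q^(N-j)) + (1 - q^(j+1))` times a common
  -- product. For `N < j` the subtraction truncates, but the common product contains `1 - q^0 = 0`.
  rcases le_or_gt j N with h | h
  · obtain ⟨c, rfl⟩ := Nat.exists_eq_add_of_le h
    rw [Nat.add_sub_cancel_left]
    ring
  · rw [Finset.prod_eq_zero (Finset.mem_range.2 h) (by simp : (1 - q ^ (N - N) : Series) = 0)]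
    ring

/-! ### The numerator and the denominator as polynomials in `z = x ^ 2` -/

/-- The coefficient of `(-z) ^ (j + 1) * q ^ (j + 2).choose 2` in the denominator. -/
noncomputable def denomCoeff (d j : ℕ) : Series :=
  ∑ i ∈ Finset.range (d - j), (y * q) ^ i * qBinom (d - i) (j + 1) * qBinom (i + j) j

/-- The coefficient of `(-z) ^ (j + 1) * q ^ (j + 2).choose 2` in the numerator. -/
noncomputable def numerCoeff (d j : ℕ) : Series :=
  ∑ i ∈ Finset.range (d - j), (y * q) ^ i * qBinom (d - i - 1) j * qBinom (i + j) j

/-- The denominator, with `z` for `x ^ 2`. -/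
noncomputable def denomPoly (d : ℕ) (z : Series) : Series :=
  1 + ∑ j ∈ Finset.range d, (-z) ^ (j + 1) * q ^ (j + 2).choose 2 * denomCoeff d j

/-- The negative of the numerator, with `z` for `x ^ 2`. -/
noncomputable def numerPoly (d : ℕ) (z : Series) : Series :=
  -∑ j ∈ Finset.range d, (-z) ^ (j + 1) * q ^ (j + 2).choose 2 * numerCoeff d j

lemma sum_Icc_one_eq (f : ℕ → Series) (k : ℕ) :
    ∑ j ∈ Finset.Icc 1 k, f j = ∑ j ∈ Finset.range k, f (j + 1) := by
  induction k with
  | zero => simp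
  | succ k ih => rw [Finset.sum_Icc_succ_top (by omega), ih, Finset.sum_range_succ]

lemma denom_eq (k : ℕ) : denom k = denomPoly k (x ^ 2) := by
  rw [denom, denomPoly, sum_Icc_one_eq]
  congr 1
  refine Finset.sum_congr rfl fun j hj => ?_
  rw [Finset.mem_range] at hj
  rw [denomCoeff, neg_pow (x ^ 2), ← pow_mul, Nat.add_sub_cancel,
    show k - (j + 1) + 1 = k - j by omega]
  rfl

lemma numer_eq (k : ℕ) : -numer k = numerPoly k (x ^ 2) := by
  rw [numer, numerPoly, sum_Icc_one_eq]
  congr 1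
  refine Finset.sum_congr rfl fun j hj => ?_
  rw [Finset.mem_range] at hj
  rw [numerCoeff, neg_pow (x ^ 2), ← pow_mul, Nat.add_sub_cancel,
    show k - (j + 1) + 1 = k - j by omega]
  rfl

lemma constantCoeff_denom (k : ℕ) : MvPowerSeries.constantCoeff (denom k) = 1 := by
  rw [denom_eq, denomPoly, map_add, map_one, map_sum, Finset.sum_eq_zero, add_zero]
  intro j _
  simp [x]

lemma denomCoeff_self (d : ℕ) : denomCoeff d d = 0 := by simp [denomCoeff]

/-- The q-Pascal rule is applied to the first binomial of each summand. -/
lemma denomCoeff_succ {d j : ℕ} (h : j ≤ d) :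
    denomCoeff (d + 1) j = q ^ (j + 1) * denomCoeff d j + numerCoeff (d + 1) j := by
  -- The extra term `i = d - j` contains `qBinom j (j + 1) = 0`; adding it aligns the ranges.
  have hd : denomCoeff d j = ∑ i ∈ Finset.range (d + 1 - j),
      (y * q) ^ i * qBinom (d - i) (j + 1) * qBinom (i + j) j := by
    rw [denomCoeff, Nat.succ_sub h, Finset.sum_range_succ, qBinom_eq_zero (by omega)]
    simp
  rw [hd, denomCoeff, numerCoeff, Finset.mul_sum, ← Finset.sum_add_distrib]
  refine Finset.sum_congr rfl fun i hi => ?_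
  rw [Finset.mem_range] at hi
  rw [show d + 1 - i = d - i + 1 by omega, qBinom_succ_succ, Nat.add_sub_cancel]
  ring

lemma numerCoeff_succ_zero (d : ℕ) :
    numerCoeff (d + 1) 0 = 1 + y * q * numerCoeff d 0 := by
  simp only [numerCoeff, qBinom_zero_right, mul_one, Nat.sub_zero]
  rw [Finset.sum_range_succ', Finset.mul_sum, pow_zero, add_comm]
  simp only [pow_succ']

/-- Here the q-Pascal rule splits the second binomial. One half is `denomCoeff d j`; the other
vanishes at `i = 0`, and the shift of `i` by one releases the factor `y * q`. -/
lemma numerCoeff_succ_succ (d j : ℕ) :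
    numerCoeff (d + 1) (j + 1) = denomCoeff d j + y * q ^ (j + 2) * numerCoeff d (j + 1) := by
  rw [numerCoeff, denomCoeff, Nat.add_sub_add_right]
  have h1 : ∀ i ∈ Finset.range (d - j),
      (y * q) ^ i * qBinom (d + 1 - i - 1) (j + 1) * qBinom (i + (j + 1)) (j + 1) =
      (y * q) ^ i * qBinom (d - i) (j + 1) * qBinom (i + j) j +
      (y * q) ^ i * qBinom (d - i) (j + 1) * q ^ (j + 1) * qBinom (i + j) (j + 1) := by
    intro i _
    rw [show d + 1 - i - 1 = d - i by omega, ← add_assoc i, qBinom_succ_succ]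
    ring
  rw [Finset.sum_congr rfl h1, Finset.sum_add_distrib]
  congr 1
  rcases hd : d - j with _ | e
  · rw [numerCoeff, show d - (j + 1) = 0 by omega]
    simp
  · rw [Finset.sum_range_succ', qBinom_eq_zero (by omega : 0 + j < j + 1), mul_zero, add_zero,
      numerCoeff, show d - (j + 1) = e by omega, Finset.mul_sum]
    refine Finset.sum_congr rfl fun i _ => ?_
    rw [show d - (i + 1) = d - i - 1 by omega, show i + 1 + j = i + (j + 1) by omega]
    ring

lemma choose_two_succ (j : ℕ) : (j + 1 + 2).choose 2 = (j + 2).choose 2 + (j + 2) := by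
  rw [Nat.choose_succ_succ' (j + 2) 1, Nat.choose_one_right, add_comm]

@[simp] lemma numerPoly_zero (z : Series) : numerPoly 0 z = 0 := by simp [numerPoly]

@[simp] lemma denomPoly_zero (z : Series) : denomPoly 0 z = 1 := by simp [denomPoly]

/-- The factor `q ^ (j + 1)` in `denomCoeff_succ` is exactly what `z ↦ z * q` produces in `(-z) ^ (j
+ 1)`. -/
lemma denomPoly_succ (d : ℕ) (z : Series) :
    denomPoly (d + 1) z = denomPoly d (z * q) - numerPoly (d + 1) z := by
  have h : denomPoly d (z * q) = 1 + ∑ j ∈ Finset.range (d + 1),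
      (-(z * q)) ^ (j + 1) * q ^ (j + 2).choose 2 * denomCoeff d j := by
    rw [denomPoly, Finset.sum_range_succ, denomCoeff_self, mul_zero, add_zero]
  rw [h, denomPoly, numerPoly, sub_neg_eq_add, add_assoc, ← Finset.sum_add_distrib]
  congr 1
  refine Finset.sum_congr rfl fun j hj => ?_
  rw [denomCoeff_succ (by simpa [Nat.lt_succ_iff] using hj), ← neg_mul, mul_pow]
  ring

lemma numerPoly_succ (d : ℕ) (z : Series) :
    numerPoly (d + 1) z = z * q * denomPoly d (z * q) + y * numerPoly d (z * q) := by
  have h : numerPoly d (z * q) = -∑ j ∈ Finset.range (d + 1),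
      (-(z * q)) ^ (j + 1) * q ^ (j + 2).choose 2 * numerCoeff d j := by
    rw [numerPoly, Finset.sum_range_succ]
    simp [numerCoeff]
  rw [h, numerPoly, denomPoly, Finset.sum_range_succ', Finset.sum_range_succ',
    numerCoeff_succ_zero]
  simp only [numerCoeff_succ_succ, choose_two_succ]
  -- In the first part `q^(j+2)` from the binomial exponent splits into the `q` of the prefactor `z
  -- * q` and the `q^(j+1)` of the shift; in the second part the shift absorbs the `q^(j+2)` next to
  -- `y`.
  have e : ∀ j ∈ Finset.range d,
      (-z) ^ (j + 1 + 1) * q ^ ((j + 2).choose 2 + (j + 2)) *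
        (denomCoeff d j + y * q ^ (j + 2) * numerCoeff d (j + 1)) =
      -(z * q) * ((-(z * q)) ^ (j + 1) * q ^ (j + 2).choose 2 * denomCoeff d j) +
      y * ((-(z * q)) ^ (j + 1 + 1) * q ^ ((j + 2).choose 2 + (j + 2)) *
        numerCoeff d (j + 1)) := by
    intro j _
    rw [← neg_mul, mul_pow, mul_pow]
    ring
  rw [Finset.sum_congr rfl e, Finset.sum_add_distrib, ← Finset.mul_sum, ← Finset.mul_sum]
  simp only [Nat.choose_self, zero_add]
  ring

/-! ### The linear system for the columns -/

/-- The operator that adjoins a new first column of length `n`. -/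
noncomputable def adjoin (k : ℕ) (f : ℕ → Series) (n : ℕ) : Series :=
  x ^ 2 * q ^ n * ∑ m ∈ Finset.Icc 1 n, ∑ r ∈ Finset.Icc m k, y ^ (r - m) * f r

/-- The generating function of the column sequences of width `w + 1` that start with a column
of length `n`, except that the height of the first column is not counted. -/
noncomputable def widthSeries (k : ℕ) : ℕ → ℕ → Series
  | 0, n => x ^ 2 * q ^ n
  | w + 1, n => adjoin k (widthSeries k w) n

/-- The denominator times the generating function of the column sequences that start with a
column of length `n`, where the height of the first column is not counted. -/
noncomputable def solution (k n : ℕ) : Series :=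
  x ^ 2 * q ^ n * denomPoly (k - n) (x ^ 2 * q ^ n)

lemma numerPoly_step {k n : ℕ} (h : n < k) :
    numerPoly (k - n) (x ^ 2 * q ^ n) =
      solution k (n + 1) + y * numerPoly (k - (n + 1)) (x ^ 2 * q ^ (n + 1)) := by
  rw [show k - n = k - (n + 1) + 1 by omega, numerPoly_succ, solution, pow_succ]
  ring_nf

lemma denomPoly_step {k n : ℕ} (h : n < k) :
    denomPoly (k - (n + 1)) (x ^ 2 * q ^ (n + 1)) =
      denomPoly (k - n) (x ^ 2 * q ^ n) + numerPoly (k - n) (x ^ 2 * q ^ n) := by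
  rw [show k - n = k - (n + 1) + 1 by omega, denomPoly_succ, pow_succ]
  ring_nf

/-- `numerPoly_step` is a Horner scheme in `y` for the tail sum, unrolled downwards from `n = k`,
where both sides are `0`. -/
lemma sum_solution {k n : ℕ} (h : n ≤ k) :
    ∑ r ∈ Finset.Icc (n + 1) k, y ^ (r - (n + 1)) * solution k r =
      numerPoly (k - n) (x ^ 2 * q ^ n) := by
  induction h using Nat.decreasingInduction with
  | self => simp
  | of_succ n hn ih =>
    rw [numerPoly_step hn, ← ih, Finset.mul_sum, ← Finset.insert_Icc_add_one_left_eq_Icc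
      (by omega : n + 1 ≤ k), Finset.sum_insert (by simp)]
    congr 1
    · simp
    · refine Finset.sum_congr rfl fun r hr => ?_
      rw [Finset.mem_Icc] at hr
      rw [← mul_assoc, ← pow_succ']
      congr 2
      omega

/-- By `denomPoly_step` the series `denomPoly (k - n) (x ^ 2 * q ^ n)` grows with `n` by values of
`numerPoly`, which are tail sums of `solution`; telescoping starts from `denom k` at `n = 0`. -/
lemma solution_eq {k n : ℕ} (h : n ≤ k) :
    solution k n = denom k * widthSeries k 0 n + adjoin k (solution k) n := by
  have key : ∀ n ≤ k, denomPoly (k - n) (x ^ 2 * q ^ n) = denom k +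
      ∑ m ∈ Finset.Icc 1 n, ∑ r ∈ Finset.Icc m k, y ^ (r - m) * solution k r := by
    intro n
    induction n with
    | zero => simp [denom_eq]
    | succ n ih =>
      intro h
      rw [denomPoly_step h, ih (by omega), Finset.sum_Icc_succ_top (by omega), ← sum_solution
        (by omega : n ≤ k), add_assoc]
  rw [solution, key n h, widthSeries, adjoin]
  ring

/-- By linearity the error for `M + 1` is `adjoin` applied to the error for `M`, which gains a
factor `x ^ 2`. Since `adjoin` only reads entries `r ≤ k`, the restriction on `n` is preserved. -/
lemma dvd_solution_sub (k M : ℕ) : ∀ n ≤ k,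
    x ^ (2 * M) ∣ solution k n - denom k * ∑ w ∈ Finset.range M, widthSeries k w n := by
  induction M with
  | zero => simp
  | succ M ih =>
    intro n hn
    have e : solution k n - denom k * ∑ w ∈ Finset.range (M + 1), widthSeries k w n =
        x ^ 2 * (q ^ n * ∑ m ∈ Finset.Icc 1 n, ∑ r ∈ Finset.Icc m k, y ^ (r - m) *
          (solution k r - denom k * ∑ w ∈ Finset.range M, widthSeries k w r)) := by
      have e1 : ∑ w ∈ Finset.range M, adjoin k (widthSeries k w) n =
          adjoin k (fun r => ∑ w ∈ Finset.range M, widthSeries k w r) n := by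
        simp only [adjoin, Finset.mul_sum]
        rw [Finset.sum_comm]
        refine Finset.sum_congr rfl fun m _ => ?_
        rw [Finset.sum_comm]
      rw [solution_eq hn, Finset.sum_range_succ']
      simp only [widthSeries]
      rw [e1]
      simp only [adjoin, mul_sub, Finset.sum_sub_distrib, ← mul_left_comm (denom k),
        ← Finset.mul_sum]
      ring
    rw [e, mul_add, mul_one, add_comm, pow_add]
    refine mul_dvd_mul_left _ (Dvd.dvd.mul_left ?_ _)
    refine Finset.dvd_sum fun m _ => Finset.dvd_sum fun r hr => Dvd.dvd.mul_left ?_ _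
    exact ih r (Finset.mem_Icc.1 hr).2

lemma dvd_numer_sub (k M : ℕ) :
    x ^ (2 * M) ∣ -(y * numer k) - denom k *
      ∑ w ∈ Finset.range M, ∑ n ∈ Finset.Icc 1 k, y ^ n * widthSeries k w n := by
  have h := sum_solution (Nat.zero_le k)
  simp only [zero_add, Nat.sub_zero, pow_zero, mul_one] at h
  have e : -(y * numer k) - denom k *
      ∑ w ∈ Finset.range M, ∑ n ∈ Finset.Icc 1 k, y ^ n * widthSeries k w n =
      ∑ n ∈ Finset.Icc 1 k, y ^ n *
        (solution k n - denom k * ∑ w ∈ Finset.range M, widthSeries k w n) := by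
    rw [← mul_neg, numer_eq, ← h, Finset.sum_comm]
    simp only [mul_sub, Finset.sum_sub_distrib, ← mul_left_comm (denom k), ← Finset.mul_sum]
    congr 1
    rw [Finset.mul_sum]
    refine Finset.sum_congr rfl fun n hn => ?_
    rw [Finset.mem_Icc] at hn
    rw [← mul_assoc, ← pow_succ', Nat.sub_add_cancel hn.1]
  rw [e]
  exact Finset.dvd_sum fun n hn => Dvd.dvd.mul_left
    (dvd_solution_sub k M n (Finset.mem_Icc.1 hn).2) _


/-! ### Paths and the ordinates of their east steps -/

lemma endpoint_north_cons (p : List Step) :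
    endpoint (Step.north :: p) = ((endpoint p).1, (endpoint p).2 + 1) := by
  simp [endpoint]

lemma endpoint_east_cons (p : List Step) :
    endpoint (Step.east :: p) = ((endpoint p).1 + 1, (endpoint p).2) := by
  simp [endpoint]

@[simp] lemma endpoint_nil : endpoint [] = (0, 0) := rfl

lemma endpoint_add (p : List Step) : (endpoint p).1 + (endpoint p).2 = p.length := by
  induction p with
  | nil => rfl
  | cons s p ih =>
    cases s
    · rw [endpoint_north_cons, List.length_cons]; omega
    · rw [endpoint_east_cons, List.length_cons]; omega

lemma endpoint_take_add {p : List Step} {i : ℕ} (h : i ≤ p.length) :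
    (endpoint (p.take i)).1 + (endpoint (p.take i)).2 = i := by
  rw [endpoint_add, List.length_take, min_eq_left h]

lemma length_eastHeights (h : ℕ) (p : List Step) :
    (eastHeights h p).length = (endpoint p).1 := by
  induction p generalizing h with
  | nil => rfl
  | cons s p ih =>
    cases s
    · rw [eastHeights, ih, endpoint_north_cons]
    · rw [eastHeights, List.length_cons, ih, endpoint_east_cons]

lemma eastHeights_bounds (h : ℕ) (p : List Step) :
    ∀ e ∈ eastHeights h p, h ≤ e ∧ e ≤ h + (endpoint p).2 := by
  induction p generalizing h with
  | nil => simp [eastHeights]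
  | cons s p ih =>
    intro e he
    cases s
    · rw [eastHeights] at he
      have := ih _ e he
      rw [endpoint_north_cons]
      dsimp only
      omega
    · rw [eastHeights, List.mem_cons] at he
      rw [endpoint_east_cons]
      dsimp only
      rcases he with rfl | he
      · omega
      · exact ih _ e he

lemma pairwise_eastHeights (h : ℕ) (p : List Step) : (eastHeights h p).Pairwise (· ≤ ·) := by
  induction p generalizing h with
  | nil => simp [eastHeights]
  | cons s p ih =>
    cases s
    · exact ih _
    · exact List.pairwise_cons.2 ⟨fun e he => (eastHeights_bounds h p e he).1, ih _⟩

/-- The points of the path before and after the east step with index `a`. -/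
lemma endpoint_take_of_eastHeights {h a e : ℕ} {p : List Step}
    (he : (eastHeights h p)[a]? = some (h + e)) :
    a + e + 1 ≤ p.length ∧ endpoint (p.take (a + e)) = (a, e) ∧
      endpoint (p.take (a + e + 1)) = (a + 1, e) := by
  induction p generalizing h a e with
  | nil => simp [eastHeights] at he
  | cons s p ih =>
    cases s
    · rw [eastHeights] at he
      have h1 := (eastHeights_bounds _ _ _ (List.mem_of_getElem? he)).1
      obtain ⟨e, rfl⟩ : ∃ e', e = e' + 1 := ⟨e - 1, by omega⟩
      rw [show h + (e + 1) = h + 1 + e by omega] at he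
      obtain ⟨h2, h3, h4⟩ := ih he
      refine ⟨by rw [List.length_cons]; omega, ?_, ?_⟩
      · rw [← add_assoc, List.take_succ_cons, endpoint_north_cons, h3]
      · rw [← add_assoc, List.take_succ_cons, endpoint_north_cons, h4]
    · rw [eastHeights] at he
      cases a with
      | zero =>
        obtain rfl : e = 0 := by simpa using he
        simp [endpoint]
      | succ a =>
        rw [List.getElem?_cons_succ] at he
        obtain ⟨h2, h3, h4⟩ := ih he
        refine ⟨by rw [List.length_cons]; omega, ?_, ?_⟩
        · rw [add_right_comm, List.take_succ_cons, endpoint_east_cons, h3]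
        · rw [add_right_comm a 1 e, List.take_succ_cons, endpoint_east_cons, h4]

lemma eastHeights_le_of_lt {h a e : ℕ} {p : List Step} (i : ℕ)
    (he : (eastHeights h p)[a]? = some e) (ha : a < (endpoint (p.take i)).1) :
    e ≤ h + (endpoint (p.take i)).2 := by
  induction p generalizing h a i with
  | nil => simp [eastHeights] at he
  | cons s p ih =>
    cases i with
    | zero => simp at ha
    | succ i =>
      rw [List.take_succ_cons] at ha ⊢
      cases s
      · rw [endpoint_north_cons] at ha ⊢
        have := ih i he ha
        dsimp only
        omega
      · rw [endpoint_east_cons] at ha ⊢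
        dsimp only at ha ⊢
        rw [eastHeights] at he
        cases a with
        | zero =>
          obtain rfl : h = e := by simpa using he
          omega
        | succ a => exact ih i (by simpa using he) (by omega)

lemma le_eastHeights_of_le {h a e : ℕ} {p : List Step} (i : ℕ)
    (he : (eastHeights h p)[a]? = some e) (ha : (endpoint (p.take i)).1 ≤ a) :
    h + (endpoint (p.take i)).2 ≤ e := by
  induction p generalizing h a i with
  | nil => simp [eastHeights] at he
  | cons s p ih =>
    cases i with
    | zero =>
      rw [List.take_zero, endpoint_nil]
      exact (eastHeights_bounds _ _ _ (List.mem_of_getElem? he)).1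
    | succ i =>
      rw [List.take_succ_cons] at ha ⊢
      cases s
      · rw [endpoint_north_cons] at ha ⊢
        have := ih i he ha
        dsimp only
        omega
      · rw [endpoint_east_cons] at ha ⊢
        dsimp only at ha ⊢
        rw [eastHeights] at he
        cases a with
        | zero => omega
        | succ a => exact ih i (by simpa using he) (by omega)

lemma endpoint_replicate_north (n : ℕ) (p : List Step) :
    endpoint (List.replicate n Step.north ++ p) = ((endpoint p).1, n + (endpoint p).2) := by
  simp [endpoint, List.count_replicate]

lemma eastHeights_replicate_north (h n : ℕ) (p : List Step) :
    eastHeights h (List.replicate n Step.north ++ p) = eastHeights (h + n) p := by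
  induction n generalizing h with
  | zero => rfl
  | succ n ih =>
    rw [List.replicate_succ, List.cons_append, eastHeights, ih]
    congr 1
    omega

lemma exists_path {h H : ℕ} {es : List ℕ} (hs : es.Pairwise (· ≤ ·)) (hh : h ≤ H)
    (hes : ∀ e ∈ es, h ≤ e ∧ e ≤ H) :
    ∃ p, eastHeights h p = es ∧ endpoint p = (es.length, H - h) := by
  induction es generalizing h with
  | nil =>
    refine ⟨List.replicate (H - h) Step.north ++ [], ?_, ?_⟩
    · rw [eastHeights_replicate_north]; rfl
    · rw [endpoint_replicate_north]; rfl
  | cons e es ih =>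
    rw [List.pairwise_cons] at hs
    have he := hes e (by simp)
    obtain ⟨p, hp1, hp2⟩ := ih hs.2 he.2 fun f hf => ⟨hs.1 f hf, (hes f (by simp [hf])).2⟩
    refine ⟨List.replicate (e - h) Step.north ++ Step.east :: p, ?_, ?_⟩
    · rw [eastHeights_replicate_north, Nat.add_sub_cancel' he.1, eastHeights, hp1]
    · rw [endpoint_replicate_north, endpoint_east_cons, hp2, List.length_cons]
      dsimp only
      congr 1
      omega

/-! ### Sequences of columns -/

/-- The column with cells at heights in `[c'.1, c'.2)` may stand to the right of the column with
cells at heights in `[c.1, c.2)`. -/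
def Follows (c c' : ℕ × ℕ) : Prop := c.1 ≤ c'.1 ∧ c'.1 < c.2 ∧ c.2 ≤ c'.2

/-- The list of the columns of a parallelogram polyomino. -/
structure IsColumns (L : List (ℕ × ℕ)) : Prop where
  head : (L.map Prod.fst).head? = some 0
  chain : L.IsChain Follows
  lt : ∀ c ∈ L, c.1 < c.2

/-- The finite set of cells with given columns. -/
def cells : List (ℕ × ℕ) → Finset (ℕ × ℕ)
  | [] => ∅
  | c :: L => (Finset.Ico c.1 c.2).image (fun b => (0, b)) ∪
      (cells L).image (fun d => (d.1 + 1, d.2))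

lemma mem_cells_cons_zero {c : ℕ × ℕ} {L : List (ℕ × ℕ)} {b : ℕ} :
    (0, b) ∈ cells (c :: L) ↔ c.1 ≤ b ∧ b < c.2 := by
  simp [cells]

lemma mem_cells_cons_succ {c : ℕ × ℕ} {L : List (ℕ × ℕ)} {a b : ℕ} :
    (a + 1, b) ∈ cells (c :: L) ↔ (a, b) ∈ cells L := by
  simp [cells]

lemma mem_cells {L : List (ℕ × ℕ)} {a b : ℕ} :
    (a, b) ∈ cells L ↔ ∃ c, L[a]? = some c ∧ c.1 ≤ b ∧ b < c.2 := by
  induction L generalizing a with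
  | nil => simp [cells]
  | cons c L ih =>
    cases a with
    | zero => simp [mem_cells_cons_zero]
    | succ a => rw [mem_cells_cons_succ, ih, List.getElem?_cons_succ]

lemma cells_injOn : Set.InjOn cells {L | ∀ c ∈ L, c.1 < c.2} := by
  intro L
  induction L with
  | nil =>
    intro _ L' h' h
    cases L' with
    | nil => rfl
    | cons c L' =>
      have h1 : (0, c.1) ∈ cells (c :: L') := mem_cells_cons_zero.2 ⟨le_rfl, h' c (by simp)⟩
      rw [← h] at h1
      simp [cells] at h1
  | cons c L ih =>
    intro h0 L' h' h
    have hc : c.1 < c.2 := h0 c (by simp)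
    cases L' with
    | nil =>
      have h1 : (0, c.1) ∈ cells (c :: L) := mem_cells_cons_zero.2 ⟨le_rfl, hc⟩
      rw [h] at h1
      simp [cells] at h1
    | cons c' L' =>
      have hc' : c'.1 < c'.2 := h' c' (by simp)
      have hcol : ∀ b, (c.1 ≤ b ∧ b < c.2) ↔ (c'.1 ≤ b ∧ b < c'.2) := fun b => by
        rw [← mem_cells_cons_zero (L := L), h, mem_cells_cons_zero]
      have e : c = c' := by
        -- The lowest and highest cells of the two nonempty intervals determine their ends.
        have h1 := hcol c.1
        have h2 := hcol c'.1
        have h3 := hcol (c.2 - 1)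
        have h4 := hcol (c'.2 - 1)
        ext <;> omega
      have e' : L = L' := by
        refine ih (fun d hd => h0 d (by simp [hd])) (fun d hd => h' d (by simp [hd])) ?_
        ext ⟨a, b⟩
        rw [← mem_cells_cons_succ (c := c), h, mem_cells_cons_succ]
      rw [e, e']

lemma shift_injective : Function.Injective (fun d : ℕ × ℕ => (d.1 + 1, d.2)) := by
  rintro ⟨a, b⟩ ⟨a', b'⟩ h
  simpa using h

lemma area_cells (L : List (ℕ × ℕ)) :
    area (cells L) = (L.map fun c => c.2 - c.1).sum := by
  induction L with
  | nil => rfl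
  | cons c L ih =>
    rw [area, cells, Finset.card_union_of_disjoint, Finset.card_image_of_injective _
      (Prod.mk_right_injective 0), Finset.card_image_of_injective _ shift_injective, Nat.card_Ico,
      List.map_cons, List.sum_cons, ← ih, area]
    rw [Finset.disjoint_left]
    rintro ⟨a, b⟩ h1 h2
    simp only [Finset.mem_image, Prod.mk.injEq] at h1 h2
    obtain ⟨_, _, h1, _⟩ := h1
    obtain ⟨_, _, h2, _⟩ := h2
    omega

lemma width_cells {L : List (ℕ × ℕ)} (h : ∀ c ∈ L, c.1 < c.2) : width (cells L) = L.length := by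
  suffices (cells L).image Prod.fst = Finset.range L.length by
    rw [width, this, Finset.card_range]
  ext a
  rw [Finset.mem_image, Finset.mem_range]
  constructor
  · rintro ⟨⟨a, b⟩, hab, rfl⟩
    obtain ⟨c, hc, _⟩ := mem_cells.1 hab
    exact (List.getElem?_eq_some_iff.1 hc).1
  · intro ha
    exact ⟨(a, L[a].1), mem_cells.2 ⟨L[a], List.getElem?_eq_getElem ha, le_rfl,
      h _ (List.getElem_mem ha)⟩, rfl⟩

lemma columnLength_cells (L : List (ℕ × ℕ)) (a : ℕ) :
    columnLength (cells L) a = ((L[a]?).map fun c : ℕ × ℕ => c.2 - c.1).getD 0 := by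
  have h : (cells L).filter (fun c => c.1 = a) =
      (((L[a]?).map fun c : ℕ × ℕ => Finset.Ico c.1 c.2).getD ∅).image fun b => (a, b) := by
    ext ⟨a', b⟩
    rw [Finset.mem_filter, mem_cells]
    cases hL : L[a]? with
    | none =>
      simp only [Option.map_none, Option.getD_none, Finset.image_empty, Finset.notMem_empty,
        iff_false]
      rintro ⟨⟨c, hc, _⟩, rfl⟩
      simp [hL] at hc
    | some c =>
      simp only [Option.map_some, Option.getD_some, Finset.mem_image, Finset.mem_Ico,
        Prod.mk.injEq]
      constructor
      · rintro ⟨⟨c', hc', h⟩, rfl⟩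
        obtain rfl : c = c' := by simpa [hL] using hc'
        exact ⟨b, h, rfl, rfl⟩
      · rintro ⟨b', h, rfl, rfl⟩
        exact ⟨⟨c, hL, h⟩, rfl⟩
  rw [columnLength, h, Finset.card_image_of_injective _ (Prod.mk_right_injective a)]
  cases L[a]? <;> simp

lemma columnLength_cells_le_iff {L : List (ℕ × ℕ)} {k : ℕ} :
    (∀ a, columnLength (cells L) a ≤ k) ↔ ∀ c ∈ L, c.2 ≤ c.1 + k := by
  simp only [columnLength_cells]
  constructor
  · intro h c hc
    obtain ⟨a, ha⟩ := List.mem_iff_getElem?.1 hc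
    have := h a
    simp only [ha, Option.map_some, Option.getD_some] at this
    omega
  · intro h a
    cases ha : L[a]? with
    | none => simp
    | some c =>
      have := h c (List.mem_of_getElem? ha)
      simp only [Option.map_some, Option.getD_some]
      omega

/-- The height of the top of the last column. -/
def top (L : List (ℕ × ℕ)) : ℕ := ((L.map Prod.snd).getLast?).getD 0

@[simp] lemma top_singleton (c : ℕ × ℕ) : top [c] = c.2 := rfl

@[simp] lemma top_cons_cons (c c' : ℕ × ℕ) (L : List (ℕ × ℕ)) :
    top (c :: c' :: L) = top (c' :: L) := by
  simp [top]

lemma le_top {c : ℕ × ℕ} {L : List (ℕ × ℕ)} (h : (c :: L).IsChain Follows) :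
    c.2 ≤ top (c :: L) := by
  induction L generalizing c with
  | nil => simp
  | cons c' L ih =>
    rw [List.isChain_cons_cons] at h
    rw [top_cons_cons]
    exact h.1.2.2.trans (ih h.2)

/-- Successive columns share a row and never descend, so the occupied rows form one interval without
gaps. -/
lemma image_snd_cells {c : ℕ × ℕ} {L : List (ℕ × ℕ)} (h : (c :: L).IsChain Follows) :
    (cells (c :: L)).image Prod.snd = Finset.Ico c.1 (top (c :: L)) := by
  induction L generalizing c with
  | nil => ext b; simp [cells]
  | cons c' L ih =>
    rw [List.isChain_cons_cons] at h
    obtain ⟨⟨h1, h2, h3⟩, h⟩ := h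
    have h4 := le_top h
    rw [cells, Finset.image_union, Finset.image_image, Finset.image_image, top_cons_cons]
    have := ih h
    simp only [Function.comp_def] at this ⊢
    rw [this, Finset.image_id']
    ext b
    simp only [Finset.mem_union, Finset.mem_Ico]
    omega

lemma height_cells {L : List (ℕ × ℕ)} (h : IsColumns L) : height (cells L) = top L := by
  have h0 := h.head
  cases L with
  | nil => simp at h0
  | cons c L =>
    rw [height, image_snd_cells h.chain, Nat.card_Ico]
    have : c.1 = 0 := by simpa using h0
    omega

/-! ### Parallelogram polyominoes and column sequences -/

lemma cellBetween_iff {u l : List Step} {a b : ℕ} :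
    CellBetween u l a b ↔ (a, b) ∈ cells ((eastHeights 0 l).zip (eastHeights 0 u)) := by
  rw [mem_cells, CellBetween]
  constructor
  · rintro ⟨lo, hi, h1, h2, h3⟩
    exact ⟨(lo, hi), List.getElem?_zip_eq_some.2 ⟨h1, h2⟩, h3⟩
  · rintro ⟨⟨lo, hi⟩, h, h3⟩
    obtain ⟨h1, h2⟩ := List.getElem?_zip_eq_some.1 h
    exact ⟨lo, hi, h1, h2, h3⟩

/-- At the abscissa after a lower east step, the upper path has not yet made the east step with
the same index. -/
lemma IsBoundary.lt_of_take {u l : List Step} (h : IsBoundary u l) {i a hi : ℕ} (h0 : 0 < i)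
    (hlen : i < u.length) (ha : (endpoint (l.take i)).1 ≤ a + 1)
    (hhi : (eastHeights 0 u)[a]? = some hi) : (endpoint (l.take i)).2 < hi := by
  have h1 := h.above i h0 hlen
  have hl : u.length = l.length := by rw [← endpoint_add, ← endpoint_add, h.endpoint_eq]
  -- After equally many steps the upper path has more north steps, hence fewer east steps, so at
  -- most `a` of them.
  have h2 := endpoint_take_add hlen.le
  have h3 := endpoint_take_add (hl ▸ hlen.le : i ≤ l.length)
  have := le_eastHeights_of_le i hhi (by omega)
  omega

lemma IsBoundary.isColumns {u l : List Step} (h : IsBoundary u l) :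
    IsColumns ((eastHeights 0 l).zip (eastHeights 0 u)) := by
  have h2 := h.two_le
  have hl : u.length = l.length := by rw [← endpoint_add, ← endpoint_add, h.endpoint_eq]
  have hw : (eastHeights 0 l).length = (eastHeights 0 u).length := by
    rw [length_eastHeights, length_eastHeights, h.endpoint_eq]
  refine ⟨?_, ?_, ?_⟩
  · rw [List.map_fst_zip hw.le]
    have h1 := h.above 1 one_pos (by omega)
    cases l with
    | nil => rw [List.length_nil] at hl; omega
    | cons s l =>
      cases s
      · have h3 := endpoint_take_add (p := u) (i := 1) (by omega)
        rw [List.take_succ_cons, endpoint_north_cons] at h1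
        dsimp only at h1
        omega
      · rfl
  · rw [List.isChain_iff_getElem]
    intro i hi
    have hi' := hi
    rw [List.length_zip] at hi'
    have p1 := List.pairwise_iff_getElem.1 (pairwise_eastHeights 0 l) i (i + 1) (by omega)
      (by omega) (by omega)
    have p2 := List.pairwise_iff_getElem.1 (pairwise_eastHeights 0 u) i (i + 1) (by omega)
      (by omega) (by omega)
    rw [List.getElem_zip, List.getElem_zip]
    refine ⟨p1, ?_, p2⟩
    dsimp only
    set e := (eastHeights 0 l)[i + 1] with he
    have he' : (eastHeights 0 l)[i + 1]? = some (0 + e) := by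
      rw [zero_add, he]; exact List.getElem?_eq_getElem _
    -- After `i + 1 + e` steps the lower path stands at `(i + 1, e)`, about to make its east step of
    -- index `i + 1`.
    obtain ⟨q1, q2, -⟩ := endpoint_take_of_eastHeights he'
    have := h.lt_of_take (i := i + 1 + e) (a := i) (by omega) (by omega) (by rw [q2])
      (List.getElem?_eq_getElem (by omega))
    rwa [q2] at this
  · rintro ⟨lo, hi⟩ hc
    obtain ⟨a, ha⟩ := List.mem_iff_getElem?.1 hc
    obtain ⟨h1, h3⟩ := List.getElem?_zip_eq_some.1 ha
    dsimp only at h1 h3 ⊢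
    rw [← zero_add lo] at h1
    obtain ⟨q1, q3, q2⟩ := endpoint_take_of_eastHeights h1
    rcases Nat.lt_or_ge (a + lo + 1) l.length with hlt | hge
    · have := h.lt_of_take (i := a + lo + 1) (by omega) (by omega) (by rw [q2]) h3
      rwa [q2] at this
    -- The lower path cannot end with an east step: one step earlier it would already have its final
    -- height, with the upper path strictly above that.
    · have e1 : a + lo + 1 = l.length := le_antisymm q1 hge
      rw [e1, List.take_length] at q2
      have e2 := h.above (a + lo) (by omega) (by omega)
      have e3 : (endpoint (u.take (a + lo))).2 ≤ (endpoint u).2 :=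
        (List.take_sublist _ _).count_le _
      rw [h.endpoint_eq, q2] at e3
      rw [q3] at e2
      exact absurd e3 (not_le.2 e2)

lemma IsColumns.exists_isBoundary {L : List (ℕ × ℕ)} (h : IsColumns L) :
    ∃ u l, IsBoundary u l ∧ (eastHeights 0 l).zip (eastHeights 0 u) = L := by
  have hne : 0 < L.length := by
    have h0 := h.head
    cases L with
    | nil => simp at h0
    | cons c L => simp
  have s1 : (L.map Prod.fst).Pairwise (· ≤ ·) := by
    rw [← List.isChain_iff_pairwise, List.isChain_map]
    exact h.chain.imp fun _ _ hc => hc.1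
  have s2 : (L.map Prod.snd).Pairwise (· ≤ ·) := by
    rw [← List.isChain_iff_pairwise, List.isChain_map]
    exact h.chain.imp fun _ _ hc => hc.2.2
  have hlast : (L.map Prod.snd)[L.length - 1]? = some (top L) := by
    rw [top, List.getLast?_eq_getElem?, List.length_map,
      List.getElem?_eq_getElem (by rw [List.length_map]; omega), Option.getD_some]
  have htop : ∀ c ∈ L, c.2 ≤ top L := by
    intro c hc
    obtain ⟨a, ha, rfl⟩ := List.mem_iff_getElem.1 hc
    obtain ⟨hb, hlast⟩ := List.getElem?_eq_some_iff.1 hlast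
    rw [← hlast]
    rcases (by omega : a < L.length - 1 ∨ a = L.length - 1) with hlt | rfl
    · have := List.pairwise_iff_getElem.1 s2 a (L.length - 1) (by simpa using ha) hb hlt
      rwa [List.getElem_map] at this
    · simp
  have hpos : 0 < top L := (Nat.zero_le _).trans_lt
    ((h.lt _ (List.getElem_mem hne)).trans_le (htop _ (List.getElem_mem hne)))
  obtain ⟨u, hu1, hu2⟩ := exists_path (h := 0) (H := top L) s2 (Nat.zero_le _) (by
    simp only [List.mem_map]
    rintro e ⟨c, hc, rfl⟩
    exact ⟨Nat.zero_le _, htop c hc⟩)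
  obtain ⟨l, hl1, hl2⟩ := exists_path (h := 0) (H := top L) s1 (Nat.zero_le _) (by
    simp only [List.mem_map]
    rintro e ⟨c, hc, rfl⟩
    exact ⟨Nat.zero_le _, (h.lt c hc).le.trans (htop c hc)⟩)
  rw [List.length_map, Nat.sub_zero] at hu2 hl2
  have hul : u.length = L.length + top L := by rw [← endpoint_add, hu2]
  have hll : l.length = L.length + top L := by rw [← endpoint_add, hl2]
  refine ⟨u, l, ⟨by omega, by rw [hu2, hl2], ?_⟩, ?_⟩
  · intro i hi0 hi
    by_contra! hcon
    have eu := endpoint_take_add hi.le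
    have el := endpoint_take_add (by omega : i ≤ l.length)
    have hxl : (endpoint (l.take i)).1 ≤ (endpoint l).1 := (List.take_sublist _ _).count_le _
    rw [hl2] at hxl
    dsimp only at hxl
    -- If the upper path is not above after `i` steps, it has made at least as many east steps as
    -- the lower one. With no lower east step, the lower path has not left the origin. Otherwise the
    -- upper path has passed the top of column `a`, so the lower path is at least that high:
    -- impossible before its next east step by the overlap condition, and after the last column it
    -- means that the path is complete.
    rcases hx : (endpoint (l.take i)).1 with _ | a
    · have h0 : (eastHeights 0 l)[0]? = some 0 := by
        rw [hl1, ← List.head?_eq_getElem?, h.head]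
      have := le_eastHeights_of_le i h0 hx.le
      omega
    · have ha : (eastHeights 0 u)[a]? = some (L[a]'(by omega)).2 := by
        rw [hu1, List.getElem?_map, List.getElem?_eq_getElem (by omega), Option.map_some]
      have h1 := eastHeights_le_of_lt i ha (by omega)
      rcases (by omega : a + 1 < L.length ∨ a = L.length - 1) with hlt | rfl
      · have hb : (eastHeights 0 l)[a + 1]? = some (L[a + 1]'hlt).1 := by
          rw [hl1, List.getElem?_map, List.getElem?_eq_getElem hlt, Option.map_some]
        have h2 := le_eastHeights_of_le i hb hx.le
        have h3 := (List.isChain_iff_getElem.1 h.chain a hlt).2.1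
        omega
      · rw [hu1, hlast, Option.some_inj] at ha
        omega
  · rw [hl1, hu1]
    exact (List.zip_of_prod rfl rfl).symm

lemma isParallelogram_iff {P : Finset (ℕ × ℕ)} :
    IsParallelogram P ↔ ∃ L, IsColumns L ∧ cells L = P := by
  constructor
  · rintro ⟨u, l, h, hP⟩
    refine ⟨_, h.isColumns, ?_⟩
    ext ⟨a, b⟩
    rw [hP, cellBetween_iff]
  · rintro ⟨L, hL, rfl⟩
    obtain ⟨u, l, h, rfl⟩ := hL.exists_isBoundary
    exact ⟨u, l, h, fun a b => cellBetween_iff.symm⟩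


/-! ### Counting column sequences -/

/-- The columns of length at most `k` that may stand to the right of the column `c`. -/
def nextColumns (k : ℕ) (c : ℕ × ℕ) : Finset (ℕ × ℕ) :=
  (Finset.Ico c.1 c.2 ×ˢ Finset.Icc c.2 (c.2 + k)).filter fun c' => c'.2 ≤ c'.1 + k

/-- The finite box loses nothing, since `c'.2 ≤ c'.1 + k < c.2 + k`. -/
lemma mem_nextColumns {k : ℕ} {c c' : ℕ × ℕ} :
    c' ∈ nextColumns k c ↔ Follows c c' ∧ c'.2 ≤ c'.1 + k := by
  simp only [nextColumns, Finset.mem_filter, Finset.mem_product, Finset.mem_Ico, Finset.mem_Icc,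
    Follows]
  omega

/-- The column sequences of width `w + 1` that start with the column `c`, where the other columns
have length at most `k`. -/
def columnsFrom (k : ℕ) : ℕ → ℕ × ℕ → Finset (List (ℕ × ℕ))
  | 0, c => {[c]}
  | w + 1, c => (nextColumns k c).biUnion fun c' => (columnsFrom k w c').image (List.cons c)

lemma mem_columnsFrom {k w : ℕ} {c : ℕ × ℕ} {L : List (ℕ × ℕ)} :
    L ∈ columnsFrom k w c ↔ L.length = w + 1 ∧ L.head? = some c ∧ L.IsChain Follows ∧
      ∀ c' ∈ L.tail, c'.2 ≤ c'.1 + k := by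
  induction w generalizing c L with
  | zero =>
    rw [columnsFrom, Finset.mem_singleton]
    constructor
    · rintro rfl
      simp
    · rintro ⟨h1, h2, -⟩
      obtain ⟨d, rfl⟩ := List.length_eq_one_iff.1 h1
      simpa using h2
  | succ w ih =>
    simp only [columnsFrom, Finset.mem_biUnion, Finset.mem_image, mem_nextColumns, ih]
    constructor
    · rintro ⟨c', ⟨hc, hk⟩, L, ⟨h1, h2, h3, h4⟩, rfl⟩
      obtain ⟨L, rfl⟩ := List.head?_eq_some_iff.1 h2
      refine ⟨by rw [List.length_cons, h1], rfl, List.isChain_cons_cons.2 ⟨hc, h3⟩, ?_⟩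
      rw [List.tail_cons, List.forall_mem_cons]
      exact ⟨hk, h4⟩
    · rintro ⟨h1, h2, h3, h4⟩
      obtain ⟨L, rfl⟩ := List.head?_eq_some_iff.1 h2
      cases L with
      | nil => simp at h1
      | cons c' L =>
        rw [List.isChain_cons_cons] at h3
        rw [List.tail_cons, List.forall_mem_cons] at h4
        exact ⟨c', ⟨h3.1, h4.1⟩, c' :: L, ⟨by simpa using h1, rfl, h3.2, h4.2⟩, rfl⟩

/-- The weight of a column sequence. -/
noncomputable def weight (L : List (ℕ × ℕ)) : Series :=
  q ^ (L.map fun c => c.2 - c.1).sum * y ^ top L * x ^ (2 * L.length)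

lemma weight_cons_cons (c c' : ℕ × ℕ) (L : List (ℕ × ℕ)) :
    weight (c :: c' :: L) = x ^ 2 * q ^ (c.2 - c.1) * weight (c' :: L) := by
  rw [weight, weight, top_cons_cons, List.map_cons, List.sum_cons, List.length_cons, mul_add,
    pow_add, pow_add]
  ring

lemma sum_nextColumns (k : ℕ) {c : ℕ × ℕ} (hc : c.1 ≤ c.2) (f : ℕ → Series) :
    ∑ c' ∈ nextColumns k c, y ^ c'.2 * f (c'.2 - c'.1) =
      y ^ c.2 * ∑ m ∈ Finset.Icc 1 (c.2 - c.1), ∑ r ∈ Finset.Icc m k, y ^ (r - m) * f r := by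
  simp only [Finset.mul_sum]
  rw [Finset.sum_sigma']
  -- The new column is encoded by its overlap `m` with `c` and its length `r`; its top is `c.2 + (r
  -- - m)`.
  refine Finset.sum_bij' (fun c' _ => ⟨c.2 - c'.1, c'.2 - c'.1⟩)
    (fun p _ => (c.2 - p.1, c.2 - p.1 + p.2)) ?_ ?_ ?_ ?_ ?_
  · intro c' h
    rw [mem_nextColumns, Follows] at h
    simp only [Finset.mem_sigma, Finset.mem_Icc]
    omega
  · rintro ⟨m, r⟩ h
    simp only [Finset.mem_sigma, Finset.mem_Icc] at h
    rw [mem_nextColumns, Follows]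
    dsimp only
    omega
  · intro c' h
    rw [mem_nextColumns, Follows] at h
    ext <;> dsimp only <;> omega
  · rintro ⟨m, r⟩ h
    simp only [Finset.mem_sigma, Finset.mem_Icc] at h
    have h1 : c.2 - (c.2 - m) = m := by omega
    have h2 : c.2 - m + r - (c.2 - m) = r := by omega
    simp only [h1, h2]
  · intro c' h
    rw [mem_nextColumns, Follows] at h
    dsimp only
    rw [← mul_assoc, ← pow_add]
    congr 2
    omega

lemma sum_weight_columnsFrom (k w : ℕ) {c : ℕ × ℕ} (hc : c.1 ≤ c.2) :
    ∑ L ∈ columnsFrom k w c, weight L = y ^ c.2 * widthSeries k w (c.2 - c.1) := by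
  induction w generalizing c with
  | zero =>
    rw [columnsFrom, Finset.sum_singleton, weight, widthSeries]
    simp only [List.map_cons, List.map_nil, List.sum_cons, List.sum_nil, top_singleton,
      List.length_singleton, add_zero, mul_one]
    ring
  | succ w ih =>
    rw [columnsFrom, Finset.sum_biUnion]
    · have h1 : ∀ c' ∈ nextColumns k c,
          ∑ L ∈ (columnsFrom k w c').image (List.cons c), weight L =
          x ^ 2 * q ^ (c.2 - c.1) * (y ^ c'.2 * widthSeries k w (c'.2 - c'.1)) := by
        intro c' h
        rw [mem_nextColumns, Follows] at h
        rw [Finset.sum_image (List.cons_injective.injOn), ← ih (by omega), Finset.mul_sum]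
        refine Finset.sum_congr rfl fun L hL => ?_
        obtain ⟨L, rfl⟩ := List.head?_eq_some_iff.1 (mem_columnsFrom.1 hL).2.1
        exact weight_cons_cons c c' L
      rw [Finset.sum_congr rfl h1, ← Finset.mul_sum, sum_nextColumns k hc, widthSeries, adjoin]
      ring
    · intro c₁ _ c₂ _ hne
      rw [Function.onFun, Finset.disjoint_left]
      intro L h1 h2
      obtain ⟨L₁, m1, rfl⟩ := Finset.mem_image.1 h1
      obtain ⟨L₂, m2, e⟩ := Finset.mem_image.1 h2
      obtain rfl : L₂ = L₁ := by simpa using e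
      have e1 := (mem_columnsFrom.1 m1).2.1
      rw [(mem_columnsFrom.1 m2).2.1, Option.some_inj] at e1
      exact hne e1.symm

/-- The column sequences of parallelogram polyominoes of width at most `M` all of whose columns
have length at most `k`. -/
def boundedColumns (k M : ℕ) : Finset (List (ℕ × ℕ)) :=
  (Finset.range M).biUnion fun w => (Finset.Icc 1 k).biUnion fun n => columnsFrom k w (0, n)

lemma mem_boundedColumns {k M : ℕ} {L : List (ℕ × ℕ)} :
    L ∈ boundedColumns k M ↔ L.length ≤ M ∧ IsColumns L ∧ ∀ c ∈ L, c.2 ≤ c.1 + k := by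
  simp only [boundedColumns, Finset.mem_biUnion, Finset.mem_range, Finset.mem_Icc,
    mem_columnsFrom]
  constructor
  · rintro ⟨w, hw, n, hn, h1, h2, h3, h4⟩
    obtain ⟨L, rfl⟩ := List.head?_eq_some_iff.1 h2
    refine ⟨by omega, ⟨rfl, h3, ?_⟩, ?_⟩
    · rw [List.forall_mem_cons]
      refine ⟨hn.1, fun c hc => ?_⟩
      clear h1 h2 h4
      generalize (0, n) = d at h3
      induction L generalizing d with
      | nil => simp at hc
      | cons c' L ih =>
        rw [List.isChain_cons_cons] at h3
        rcases List.mem_cons.1 hc with rfl | hc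
        -- A later column is nonempty because it overlaps its left neighbour and ends no lower.
        · exact h3.1.2.1.trans_le h3.1.2.2
        · exact ih hc c' h3.2
    · rw [List.forall_mem_cons]
      exact ⟨by simpa using hn.2, h4⟩
  · rintro ⟨h1, h2, h3⟩
    have h0 := h2.head
    cases L with
    | nil => simp at h0
    | cons c L =>
      have hc : c.1 = 0 := by simpa using h0
      have hlt := h2.lt c (by simp)
      have hle := h3 c (by simp)
      refine ⟨L.length, h1, c.2, by omega, rfl, ?_, h2.chain,
        fun c' hc' => h3 c' (List.mem_cons_of_mem _ hc')⟩
      rw [List.head?_cons, ← hc]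

lemma sum_weight_boundedColumns (k M : ℕ) :
    ∑ L ∈ boundedColumns k M, weight L =
      ∑ w ∈ Finset.range M, ∑ n ∈ Finset.Icc 1 k, y ^ n * widthSeries k w n := by
  rw [boundedColumns, Finset.sum_biUnion]
  · refine Finset.sum_congr rfl fun w _ => ?_
    rw [Finset.sum_biUnion]
    · refine Finset.sum_congr rfl fun n _ => ?_
      rw [sum_weight_columnsFrom k w (Nat.zero_le n)]
      rfl
    · intro n₁ _ n₂ _ hne
      rw [Function.onFun, Finset.disjoint_left]
      intro L h1 h2
      have e := (mem_columnsFrom.1 h1).2.1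
      rw [(mem_columnsFrom.1 h2).2.1] at e
      exact hne (by simpa using e.symm)
  · intro w₁ _ w₂ _ hne
    rw [Function.onFun, Finset.disjoint_left]
    intro L h1 h2
    obtain ⟨_, _, h1⟩ := Finset.mem_biUnion.1 h1
    obtain ⟨_, _, h2⟩ := Finset.mem_biUnion.1 h2
    have e1 := (mem_columnsFrom.1 h1).1
    have e2 := (mem_columnsFrom.1 h2).1
    omega

lemma coeff_weight (L : List (ℕ × ℕ)) (m : Fin 3 →₀ ℕ) :
    MvPowerSeries.coeff m (weight L) =
      if (L.map fun c => c.2 - c.1).sum = m 0 ∧ top L = m 1 ∧ 2 * L.length = m 2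
      then 1 else 0 := by
  rw [weight, q, y, x, MvPowerSeries.X_pow_eq, MvPowerSeries.X_pow_eq, MvPowerSeries.X_pow_eq,
    MvPowerSeries.monomial_mul_monomial, MvPowerSeries.monomial_mul_monomial,
    MvPowerSeries.coeff_monomial, mul_one, mul_one]
  refine if_congr ?_ rfl rfl
  rw [Finsupp.ext_iff, Fin.forall_fin_succ, Fin.forall_fin_succ, Fin.forall_fin_succ]
  simp [Finsupp.single_apply, eq_comm]

/-- The exponent of `x` bounds the width, so a finite set of column sequences suffices for each
monomial. -/
lemma polyominoesWithWeight_eq {k M : ℕ} {m : Fin 3 →₀ ℕ} (hm : m 2 ≤ 2 * M) :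
    polyominoesWithWeight k m = cells '' ((boundedColumns k M).filter fun L =>
      (L.map fun c => c.2 - c.1).sum = m 0 ∧ top L = m 1 ∧ 2 * L.length = m 2 :
        Finset (List (ℕ × ℕ))) := by
  ext P
  rw [polyominoesWithWeight, Set.mem_ofPred_eq, isParallelogram_iff, Set.mem_image]
  constructor
  · rintro ⟨⟨L, hL, rfl⟩, hk, h0, h1, h2⟩
    rw [area_cells] at h0
    rw [height_cells hL] at h1
    rw [width_cells hL.lt] at h2
    rw [columnLength_cells_le_iff] at hk
    refine ⟨L, ?_, rfl⟩
    rw [Finset.mem_coe, Finset.mem_filter, mem_boundedColumns]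
    exact ⟨⟨by omega, hL, hk⟩, h0, h1, h2⟩
  · rintro ⟨L, h, rfl⟩
    rw [Finset.mem_coe, Finset.mem_filter, mem_boundedColumns] at h
    obtain ⟨⟨-, hL, hk⟩, h⟩ := h
    rw [area_cells, height_cells hL, width_cells hL.lt, columnLength_cells_le_iff]
    exact ⟨⟨L, hL, rfl⟩, hk, h⟩

lemma finite_polyominoesWithWeight (k : ℕ) (m : Fin 3 →₀ ℕ) :
    (polyominoesWithWeight k m).Finite := by
  rw [polyominoesWithWeight_eq (M := m 2) (by omega)]
  exact (Finset.finite_toSet _).image _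

lemma coeff_genFun {k M : ℕ} {m : Fin 3 →₀ ℕ} (hm : m 2 ≤ 2 * M) :
    MvPowerSeries.coeff m (genFun k) =
      MvPowerSeries.coeff m (∑ L ∈ boundedColumns k M, weight L) := by
  have h : MvPowerSeries.coeff m (genFun k) = ((polyominoesWithWeight k m).ncard : ℚ) := rfl
  rw [h, polyominoesWithWeight_eq hm, Set.InjOn.ncard_image, Set.ncard_coe_finset, map_sum]
  · simp only [coeff_weight, Finset.sum_boole]
  · refine cells_injOn.mono fun L hL => ?_
    rw [Finset.mem_coe, Finset.mem_filter, mem_boundedColumns] at hL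
    exact hL.1.2.1.lt

lemma dvd_genFun_sub (k M : ℕ) :
    x ^ (2 * M) ∣ genFun k -
      ∑ w ∈ Finset.range M, ∑ n ∈ Finset.Icc 1 k, y ^ n * widthSeries k w n := by
  rw [x, MvPowerSeries.X_pow_dvd_iff]
  intro m hm
  rw [← sum_weight_boundedColumns, map_sub, coeff_genFun hm.le, sub_self]

lemma genFun_mul_denom (k : ℕ) : genFun k * denom k = -(y * numer k) := by
  rw [← sub_eq_zero]
  ext m
  rw [map_zero]
  -- The choice `M = m 2 + 1` makes `2 * M` exceed the exponent of `x` in the monomial `m`.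
  have h : x ^ (2 * (m 2 + 1)) ∣ genFun k * denom k - -(y * numer k) := by
    have h1 := (dvd_genFun_sub k (m 2 + 1)).mul_left (denom k)
    have h2 := h1.sub (dvd_numer_sub k (m 2 + 1))
    convert h2 using 1
    ring
  rw [x, MvPowerSeries.X_pow_dvd_iff] at h
  exact h m (by omega)

end ParallelogramPolyomino

theorem corollary55 (k : ℕ) (hk : 1 ≤ k) :
    (∀ m : Fin 3 →₀ ℕ, (ParallelogramPolyomino.polyominoesWithWeight k m).Finite) ∧
    MvPowerSeries.constantCoeff (ParallelogramPolyomino.denom k) = 1 ∧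
    ParallelogramPolyomino.genFun k =
      -(ParallelogramPolyomino.y * ParallelogramPolyomino.numer k) *
        (ParallelogramPolyomino.denom k)⁻¹ := by
  refine ⟨ParallelogramPolyomino.finite_polyominoesWithWeight k,
    ParallelogramPolyomino.constantCoeff_denom k, ?_⟩
  rw [MvPowerSeries.eq_mul_inv_iff_mul_eq]
  · exact ParallelogramPolyomino.genFun_mul_denom k
  · rw [ParallelogramPolyomino.constantCoeff_denom]
    exact one_ne_zero
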